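/- Let $p\ge 2$ be a real number and let $E$ be a (real) Banach lattice. Recall the following notions. - $E$ has \emph{cotype} $p$ if there is a constant $C>0$ such that for all $n$ and all $x_1,\dots,x_n\in E$, $$\Big(\sum_{k=1}^n\|x_k\|^p\Big)^{1/p}\le C\Big(\int_0^1\Big\|\sum_{k=1}^n r_k(t)x_k\Big\|^2\,dt\Big)^{1/2},$$ where $r_k(t)=\operatorname{sign}(\sin(2^k\pi t))$ are the Rademacher functions. - A sequence $(x_n)_n$ in a Banach lattice $F$ is \emph{disjoint} if $|x_n|\wedge|x_m|=0$ for $n\ne m$, and \emph{weakly $p$-summable} if $\sum_n|f(x_n)|^p<\infty$ for every $f\in F^*$. - $F$ has the \emph{disjoint Dunford--Pettis property of order $p$} (disjoint $DPP_p$) if for every disjoint weakly $p$-summable sequence $(x_n)_n$ in $F$ the set $\{x_n:n\in\mathbb N\}$ is a Dunford--Pettis set, that is, $\sup_{k}|f_n(x_k)|\to 0$ as $n\to\infty$ for every weakly null sequence $(f_n)_n$ in $F^*$. The dual $E^*$ is a Banach lattice in the dual order: $f\le g$ iff $f(x)\le g(x)$ for all $x\ge 0$ in $E$. If $E$ has cotype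 $p$ and $E^*$ has the disjoint $DPP_p$, then $E$ has the disjoint $DPP_p$. -/

import Mathlib

open Filter Topology Set

set_option linter.unusedSectionVars false

/-! ### The dual of a Banach lattice as a vector lattice -/

noncomputable section DualLattice

namespace StrongDual

variable {E : Type*} [NormedAddCommGroup E] [NormedSpace ℝ E] [Lattice E] [HasSolidNorm E]
  [IsOrderedAddMonoid E]

/-- `sup {f y : 0 ≤ y ≤ x}`, the value of the positive part of `f` at `x ≥ 0`. -/
def posSup (f : StrongDual ℝ E) (x : E) : ℝ := sSup (f '' Icc 0 x)

theorem le_norm_mul_of_mem_Icc (f : StrongDual ℝ E) {x y : E} (hy : y ∈ Icc 0 x) :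
    f y ≤ ‖f‖ * ‖x‖ := by
  have h1 : ‖y‖ ≤ ‖x‖ := by
    apply norm_le_norm_of_abs_le_abs
    rw [abs_of_nonneg hy.1, abs_of_nonneg (hy.1.trans hy.2)]
    exact hy.2
  calc f y ≤ ‖f y‖ := Real.le_norm_self _
    _ ≤ ‖f‖ * ‖y‖ := f.le_opNorm y
    _ ≤ ‖f‖ * ‖x‖ := by gcongr

theorem le_posSup (f : StrongDual ℝ E) {x y : E} (h0 : 0 ≤ y) (h : y ≤ x) :
    f y ≤ posSup f x := by
  refine le_csSup ⟨‖f‖ * ‖x‖, ?_⟩ (mem_image_of_mem f ⟨h0, h⟩)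
  rintro _ ⟨z, hz, rfl⟩
  exact le_norm_mul_of_mem_Icc f hz

theorem posSup_le (f : StrongDual ℝ E) {x : E} (hx : 0 ≤ x) {c : ℝ}
    (h : ∀ y, 0 ≤ y → y ≤ x → f y ≤ c) : posSup f x ≤ c := by
  refine csSup_le ⟨f 0, mem_image_of_mem f ⟨le_rfl, hx⟩⟩ ?_
  rintro _ ⟨z, hz, rfl⟩
  exact h z hz.1 hz.2

theorem posSup_nonneg (f : StrongDual ℝ E) {x : E} (hx : 0 ≤ x) : 0 ≤ posSup f x := by
  simpa using le_posSup f le_rfl hx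

theorem posSup_add (f : StrongDual ℝ E) {a b : E} (ha : 0 ≤ a) (hb : 0 ≤ b) :
    posSup f (a + b) = posSup f a + posSup f b := by
  apply le_antisymm
  · refine posSup_le f (add_nonneg ha hb) fun y h0 h => ?_
    have h1 : 0 ≤ y - y ⊓ a := sub_nonneg.2 inf_le_left
    have h2 : y - y ⊓ a ≤ b := by
      rw [sub_le_comm]
      refine le_inf (sub_le_self y hb) ?_
      rwa [sub_le_iff_le_add]
    have h3 := le_posSup f (le_inf h0 ha) (inf_le_right : y ⊓ a ≤ a)
    have h4 := le_posSup f h1 h2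
    rw [map_sub] at h4
    linarith
  · rw [← le_sub_iff_add_le]
    refine posSup_le f ha fun y h0 h => ?_
    rw [le_sub_comm]
    refine posSup_le f hb fun z h0' h' => ?_
    have := le_posSup f (add_nonneg h0 h0') (add_le_add h h')
    rw [map_add] at this
    linarith

theorem posSup_sub_posSup (f : StrongDual ℝ E) {a b c d : E} (ha : 0 ≤ a) (hb : 0 ≤ b)
    (hc : 0 ≤ c) (hd : 0 ≤ d) (h : a - b = c - d) :
    posSup f a - posSup f b = posSup f c - posSup f d := by
  have h1 : a + d = c + b := by
    rw [sub_eq_sub_iff_add_eq_add] at h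
    exact h
  have h2 := posSup_add f ha hd
  rw [h1, posSup_add f hc hb] at h2
  linarith

/-- The positive part of `f`: the additive extension of `posSup f` from the positive cone. -/
def posPartAddHom (f : StrongDual ℝ E) : E →+ ℝ :=
  AddMonoidHom.mk' (fun x => posSup f (x ⊔ 0) - posSup f (-x ⊔ 0)) fun x y => by
    have e : ∀ z : E, (z ⊔ 0) - (-z ⊔ 0) = z := fun z => posPart_sub_negPart z
    have hn : ∀ z : E, 0 ≤ z ⊔ 0 := fun z => le_sup_right
    have h := posSup_sub_posSup f (hn (x + y)) (hn (-(x + y))) (add_nonneg (hn x) (hn y))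
      (add_nonneg (hn (-x)) (hn (-y))) (by
        rw [e, add_sub_add_comm, e, e])
    rw [h, posSup_add f (hn x) (hn y), posSup_add f (hn (-x)) (hn (-y))]
    ring

theorem abs_posPartAddHom_le (f : StrongDual ℝ E) (x : E) :
    ‖posPartAddHom f x‖ ≤ ‖f‖ * ‖x‖ := by
  have key : ∀ z : E, 0 ≤ posSup f (z ⊔ 0) ∧ posSup f (z ⊔ 0) ≤ ‖f‖ * ‖z‖ := by
    intro z
    refine ⟨posSup_nonneg f le_sup_right, posSup_le f le_sup_right fun y h0 h => ?_⟩
    have := le_norm_mul_of_mem_Icc f (x := |z|) ⟨h0, h.trans (sup_le (le_abs_self z) (abs_nonneg z))⟩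
    rwa [norm_abs_eq_norm] at this
  have h1 := key x
  have h2 := key (-x)
  rw [norm_neg] at h2
  change |posSup f (x ⊔ 0) - posSup f (-x ⊔ 0)| ≤ _
  rw [abs_le]
  constructor <;> linarith

/-- The positive part `f⁺` of a continuous functional `f`, with `f⁺ x = sup {f y : 0 ≤ y ≤ x}`
for `x ≥ 0`. -/
def positivePart (f : StrongDual ℝ E) : StrongDual ℝ E :=
  (posPartAddHom f).toRealLinearMap
    (AddMonoidHomClass.continuous_of_bound (posPartAddHom f) ‖f‖ (abs_posPartAddHom_le f))

theorem positivePart_apply (f : StrongDual ℝ E) {x : E} (hx : 0 ≤ x) :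
    positivePart f x = posSup f x := by
  change posSup f (x ⊔ 0) - posSup f (-x ⊔ 0) = _
  have h0 : posSup f (0 : E) = 0 :=
    le_antisymm (posSup_le f le_rfl fun y h h' => by simp [le_antisymm h' h])
      (posSup_nonneg f le_rfl)
  rw [sup_of_le_left hx, sup_of_le_right (neg_nonpos.2 hx), h0, sub_zero]

/-- The dual order: `f ≤ g` iff `f x ≤ g x` for all `x ≥ 0`. -/
instance instPartialOrder : PartialOrder (StrongDual ℝ E) where
  le f g := ∀ x : E, 0 ≤ x → f x ≤ g x
  le_refl _ _ _ := le_rfl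
  le_trans _ _ _ h h' x hx := (h x hx).trans (h' x hx)
  le_antisymm f g h h' := by
    have key : ∀ x : E, 0 ≤ x → f x = g x := fun x hx => le_antisymm (h x hx) (h' x hx)
    ext x
    rw [← posPart_sub_negPart x, map_sub, map_sub, key _ (posPart_nonneg x),
      key _ (negPart_nonneg x)]

theorem le_def (f g : StrongDual ℝ E) : f ≤ g ↔ ∀ x : E, 0 ≤ x → f x ≤ g x := Iff.rfl

/-- The dual of a normed vector lattice is a lattice in the dual order
(a partial order determines its suprema and infima). -/
instance instLattice : Lattice (StrongDual ℝ E) where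
  sup f g := g + positivePart (f - g)
  inf f g := f - positivePart (f - g)
  le_sup_left f g x hx := by
    have := le_posSup (f - g) hx le_rfl
    rw [add_apply, positivePart_apply _ hx]
    rw [sub_apply] at this
    linarith
  le_sup_right f g x hx := by
    have := posSup_nonneg (f - g) hx
    rw [add_apply, positivePart_apply _ hx]
    linarith
  sup_le f g h hf hg x hx := by
    rw [add_apply, positivePart_apply _ hx, ← le_sub_iff_add_le']
    refine posSup_le _ hx fun y h0 h' => ?_
    have h1 := hf y h0
    have h2 := hg (x - y) (sub_nonneg.2 h')
    rw [map_sub, map_sub] at h2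
    rw [sub_apply]
    linarith
  inf_le_left f g x hx := by
    have := posSup_nonneg (f - g) hx
    rw [sub_apply, positivePart_apply _ hx]
    linarith
  inf_le_right f g x hx := by
    have := le_posSup (f - g) hx le_rfl
    rw [sub_apply, positivePart_apply _ hx]
    rw [sub_apply] at this
    linarith
  le_inf h f g hf hg x hx := by
    rw [sub_apply, positivePart_apply _ hx, le_sub_comm]
    refine posSup_le _ hx fun y h0 h' => ?_
    have h1 := hg y h0
    have h2 := hf (x - y) (sub_nonneg.2 h')
    rw [map_sub, map_sub] at h2
    rw [sub_apply]
    linarith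

end StrongDual

end DualLattice

/-! ### Cotype -/

noncomputable section Cotype

/-- The `n`-th Rademacher function `r_n(t) = sign (sin (2 ^ n * π * t))`, for `n ≥ 1`. -/
def rademacher (n : ℕ) (t : ℝ) : ℝ := Real.sign (Real.sin (2 ^ n * Real.pi * t))

/-- `X` has cotype `p` (a notion used for `2 ≤ p < ∞`). -/
def HasCotype (X : Type*) [NormedAddCommGroup X] [NormedSpace ℝ X] (p : ℝ) : Prop :=
  ∃ C : ℝ, 0 < C ∧ ∀ (n : ℕ) (x : Fin n → X),
    (∑ k, ‖x k‖ ^ p) ^ (1 / p) ≤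
      C * (∫ t in (0 : ℝ)..1, ‖∑ k : Fin n, rademacher (k + 1) t • x k‖ ^ 2) ^ (1 / 2 : ℝ)

end Cotype

/-! ### The disjoint Dunford-Pettis property of order `p` -/

section DunfordPettis

variable {X : Type*} [NormedAddCommGroup X] [NormedSpace ℝ X]

/-- The sequence `x` converges to `0` in the weak topology of `X`. -/
def IsWeaklyNull (x : ℕ → X) : Prop :=
  Tendsto (fun n => toWeakSpace ℝ X (x n)) atTop (𝓝 0)

/-- The sequence `(f (x n))` is in `ℓ_p` for every continuous functional `f`. -/
def IsWeaklySummable (p : ℝ) (x : ℕ → X) : Prop :=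
  ∀ f : StrongDual ℝ X, Summable fun n => |f (x n)| ^ p

/-- Every weakly null sequence of functionals converges to zero uniformly on `A`. -/
def IsDunfordPettisSet (A : Set X) : Prop :=
  ∀ f : ℕ → StrongDual ℝ X, IsWeaklyNull f →
    TendstoUniformlyOn (fun n x => f n x) (fun _ => 0) atTop A

/-- The terms of the sequence `x` are pairwise disjoint elements of the vector lattice. -/
def IsDisjointSeq {E : Type*} [AddGroup E] [Lattice E] (x : ℕ → E) : Prop :=
  ∀ m n, m ≠ n → |x m| ⊓ |x n| = 0

/-- Every disjoint weakly `p`-summable sequence in the Banach lattice `E` is Dunford-Pettis. -/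
def HasDisjointDPP (p : ℝ) (E : Type*) [NormedAddCommGroup E] [NormedSpace ℝ E] [Lattice E] :
    Prop :=
  ∀ x : ℕ → E, IsDisjointSeq x → IsWeaklySummable p x → IsDunfordPettisSet (range x)

end DunfordPettis

/-! ### Disjointness in vector lattices. -/

section VectorLattice

variable {E : Type*} [AddCommGroup E] [Lattice E] [IsOrderedAddMonoid E]

/-! A disjoint weakly `p`-summable sequence `x` in `E` is in fact norm null, and by Banach–Steinhaus
a norm null sequence has Dunford–Pettis range. To see that `(x n)⁺` is norm null, norm it by a
positive functional of norm at most one and keep only the component `g n` carried by the band of `(x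
n)⁺` (`StrongDual.exists_norming_carried_by_band`). These components are disjoint in the dual.

Cotype gives a lower `p`-estimate for disjoint elements below `|y|`; applied to the truncations `|y|
⊓ k • (x n)⁺`, it yields `∑ |g n y| ^ p ≤ (C * ‖y‖) ^ p`. By Hölder duality `g` is weakly
`p`-summable, so its range is a Dunford–Pettis set. The images of `x n` in the bidual are weakly
null, hence tend to zero uniformly on that range. On the diagonal, `g n (x n) = g n (x n)⁺ ≥ ‖(x
n)⁺‖` tends to zero. Negative parts follow by passing to `-x`. -/

theorem inf_add_le_inf_add_inf {a b c : E} (ha : 0 ≤ a) (hb : 0 ≤ b) (hc : 0 ≤ c) :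
    a ⊓ (b + c) ≤ a ⊓ b + a ⊓ c := by
  rw [add_inf, inf_add, inf_add]
  refine le_inf (le_inf ?_ ?_) (le_inf ?_ inf_le_right)
  · exact inf_le_left.trans (le_add_of_nonneg_left ha)
  · exact inf_le_left.trans (le_add_of_nonneg_left hb)
  · exact inf_le_left.trans (le_add_of_nonneg_right hc)

theorem inf_add_eq_zero_of_inf_eq_zero {a b c : E} (ha : 0 ≤ a) (hb : 0 ≤ b) (hc : 0 ≤ c)
    (hab : a ⊓ b = 0) (hac : a ⊓ c = 0) : a ⊓ (b + c) = 0 := by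
  refine le_antisymm ?_ (le_inf ha (add_nonneg hb hc))
  simpa [hab, hac] using inf_add_le_inf_add_inf ha hb hc

theorem inf_nsmul_eq_zero_of_inf_eq_zero {a b : E} (ha : 0 ≤ a) (hb : 0 ≤ b)
    (hab : a ⊓ b = 0) (k : ℕ) : a ⊓ k • b = 0 := by
  induction k with
  | zero => simpa using ha
  | succ k ih =>
    rw [succ_nsmul]
    exact inf_add_eq_zero_of_inf_eq_zero ha (nsmul_nonneg hb k) hb ih hab

theorem inf_eq_zero_of_le_of_le {a b c d : E} (ha : 0 ≤ a) (hb : 0 ≤ b) (hac : a ≤ c)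
    (hbd : b ≤ d) (h : c ⊓ d = 0) : a ⊓ b = 0 :=
  le_antisymm (h ▸ inf_le_inf hac hbd) (le_inf ha hb)

/-- A finite sum of pairwise disjoint positive elements is bounded by any common upper bound. -/
theorem sum_le_of_pairwise_inf_eq_zero {ι : Type*} (s : Finset ι) (y : ι → E) {b : E}
    (hb : 0 ≤ b) (h0 : ∀ i, 0 ≤ y i) (hy : ∀ i, y i ≤ b)
    (hd : ∀ i j, i ≠ j → y i ⊓ y j = 0) : ∑ i ∈ s, y i ≤ b := by
  classical
  induction s using Finset.induction_on with
  | empty => simpa using hb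
  | insert i s hi ih =>
    have key : ∀ t : Finset ι, i ∉ t → y i ⊓ ∑ j ∈ t, y j = 0 := by
      intro t
      induction t using Finset.induction_on with
      | empty => intro _; simpa using h0 i
      | insert j t hj iht =>
        intro hij
        rw [Finset.mem_insert, not_or] at hij
        rw [Finset.sum_insert hj]
        exact inf_add_eq_zero_of_inf_eq_zero (h0 i) (h0 j) (Finset.sum_nonneg fun k _ => h0 k)
          (hd i j hij.1) (iht hij.2)
    -- The sum of two disjoint elements is their supremum.
    rw [Finset.sum_insert hi, ← inf_add_sup, key s hi, zero_add]
    exact sup_le (hy i) ih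

end VectorLattice

/-! ### Lower `p`-estimates and functionals carried by bands. -/

section NormedLattice

variable {E : Type*} [NormedAddCommGroup E] [Lattice E] [HasSolidNorm E] [IsOrderedAddMonoid E]

theorem norm_le_norm_of_nonneg_of_le {a b : E} (ha : 0 ≤ a) (hab : a ≤ b) : ‖a‖ ≤ ‖b‖ := by
  apply norm_le_norm_of_abs_le_abs
  rwa [abs_of_nonneg ha, abs_of_nonneg (ha.trans hab)]

variable [NormedSpace ℝ E]

/-- In a Banach lattice of cotype `p`, disjoint positive elements below `b` satisfy a lower
`p`-estimate. -/
theorem HasCotype.exists_sum_rpow_norm_le [IsOrderedModule ℝ E] {p : ℝ} (hp : 0 < p)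
    (h : HasCotype E p) :
    ∃ C : ℝ, 0 < C ∧ ∀ (n : ℕ) (y : Fin n → E) (b : E), 0 ≤ b → (∀ i, 0 ≤ y i) →
      (∀ i, y i ≤ b) → (∀ i j, i ≠ j → y i ⊓ y j = 0) →
      ∑ i, ‖y i‖ ^ p ≤ (C * ‖b‖) ^ p := by
  obtain ⟨C, hC, h⟩ := h
  refine ⟨C, hC, fun n y b hb h0 hy hd => ?_⟩
  have hsum : ∑ i, y i ≤ b := sum_le_of_pairwise_inf_eq_zero _ y hb h0 hy hd
  have hsign : ∀ c : ℝ, |Real.sign c| ≤ 1 := fun c => by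
    rcases Real.sign_apply_eq c with h | h | h <;> simp [h]
  -- Coefficients in `[-1, 1]` keep the modulus below `∑ y i ≤ b`, so the Rademacher average is at
  -- most `‖b‖`.
  have hnorm : ∀ t : ℝ, ‖∑ k : Fin n, rademacher (k + 1) t • y k‖ ≤ ‖b‖ := by
    intro t
    apply norm_le_norm_of_abs_le_abs
    rw [abs_of_nonneg hb, abs_le', ← Finset.sum_neg_distrib]
    constructor
    · refine (Finset.sum_le_sum fun k _ => ?_).trans hsum
      exact smul_le_of_le_one_left (h0 k) (abs_le.1 (hsign _)).2
    · refine (Finset.sum_le_sum fun k _ => ?_).trans hsum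
      rw [← neg_smul]
      exact smul_le_of_le_one_left (h0 k) (neg_le.1 (abs_le.1 (hsign _)).1)
  have hint : ∫ t in (0 : ℝ)..1, ‖∑ k : Fin n, rademacher (k + 1) t • y k‖ ^ 2 ≤ ‖b‖ ^ 2 := by
    refine (Real.le_norm_self _).trans ?_
    have := intervalIntegral.norm_integral_le_of_norm_le_const (a := (0 : ℝ)) (b := 1)
      (C := ‖b‖ ^ 2) (f := fun t => ‖∑ k : Fin n, rademacher (k + 1) t • y k‖ ^ 2)
      (fun t _ => by
        rw [Real.norm_of_nonneg (by positivity)]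
        exact pow_le_pow_left₀ (norm_nonneg _) (hnorm t) 2)
    simpa using this
  have hint0 : 0 ≤ ∫ t in (0 : ℝ)..1, ‖∑ k : Fin n, rademacher (k + 1) t • y k‖ ^ 2 :=
    intervalIntegral.integral_nonneg zero_le_one fun t _ => by positivity
  have hroot : (∫ t in (0 : ℝ)..1, ‖∑ k : Fin n, rademacher (k + 1) t • y k‖ ^ 2) ^ (1 / 2 : ℝ)
      ≤ ‖b‖ := by
    rw [← Real.sqrt_eq_rpow]
    exact Real.sqrt_le_iff.2 ⟨norm_nonneg _, hint⟩
  have hS : 0 ≤ ∑ i, ‖y i‖ ^ p := Finset.sum_nonneg fun i _ => by positivity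
  have h1 : (∑ i, ‖y i‖ ^ p) ^ (1 / p) ≤ C * ‖b‖ :=
    (h n y).trans (mul_le_mul_of_nonneg_left hroot hC.le)
  have h2 := Real.rpow_le_rpow (Real.rpow_nonneg hS _) h1 hp.le
  rwa [← Real.rpow_mul hS, one_div_mul_cancel hp.ne', Real.rpow_one] at h2

/-- A bounded function that is additive on the positive cone extends to a continuous functional. -/
theorem exists_strongDual_of_additive_on_nonneg (φ : E → ℝ) (M : ℝ)
    (hadd : ∀ a b, 0 ≤ a → 0 ≤ b → φ (a + b) = φ a + φ b)
    (h0 : ∀ a, 0 ≤ a → 0 ≤ φ a) (hM : ∀ a, 0 ≤ a → φ a ≤ M * ‖a‖) :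
    ∃ g : StrongDual ℝ E, ∀ a, 0 ≤ a → g a = φ a := by
  let T : E →+ ℝ := AddMonoidHom.mk' (fun x => φ x⁺ - φ x⁻) fun x y => by
    have e : (x + y)⁺ + (x⁻ + y⁻) = (x⁺ + y⁺) + (x + y)⁻ := by
      rw [← sub_eq_sub_iff_add_eq_add, posPart_sub_negPart, add_sub_add_comm,
        posPart_sub_negPart, posPart_sub_negPart]
    have e' := congrArg φ e
    rw [hadd _ _ (posPart_nonneg _) (add_nonneg (negPart_nonneg _) (negPart_nonneg _)),
      hadd _ _ (negPart_nonneg _) (negPart_nonneg _),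
      hadd _ _ (add_nonneg (posPart_nonneg _) (posPart_nonneg _)) (negPart_nonneg _),
      hadd _ _ (posPart_nonneg _) (posPart_nonneg _)] at e'
    linarith
  have hT : ∀ x, ‖T x‖ ≤ |M| * ‖x‖ := by
    intro x
    have key : ∀ a : E, 0 ≤ a → a ≤ |x| → φ a ≤ |M| * ‖x‖ := fun a ha hax => by
      have h1 := norm_le_norm_of_nonneg_of_le ha hax
      rw [norm_abs_eq_norm] at h1
      calc φ a ≤ M * ‖a‖ := hM a ha
        _ ≤ |M| * ‖a‖ := by gcongr; exact le_abs_self M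
        _ ≤ |M| * ‖x‖ := by gcongr
    have h1 := key x⁺ (posPart_nonneg x) (sup_le (le_abs_self x) (abs_nonneg x))
    have h2 := key x⁻ (negPart_nonneg x) (sup_le (neg_le_abs x) (abs_nonneg x))
    have h3 := h0 _ (posPart_nonneg x)
    have h4 := h0 _ (negPart_nonneg x)
    change |φ x⁺ - φ x⁻| ≤ _
    rw [abs_le]
    constructor <;> linarith
  refine ⟨T.toRealLinearMap (AddMonoidHomClass.continuous_of_bound T |M| hT), fun a ha => ?_⟩
  have hz : φ 0 = 0 := by simpa using hadd 0 0 le_rfl le_rfl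
  change φ a⁺ - φ a⁻ = φ a
  rw [posPart_of_nonneg ha, negPart_of_nonneg ha, hz, sub_zero]

/-- The positive part of a Hahn–Banach norming functional `f` works: its value at `y ≥ 0` is the
supremum of `f` over `[0, y]`. -/
theorem StrongDual.exists_nonneg_norming {u : E} (hu : 0 ≤ u) :
    ∃ h : StrongDual ℝ E, 0 ≤ h ∧ (∀ y, 0 ≤ y → h y ≤ ‖y‖) ∧ ‖u‖ ≤ h u := by
  obtain ⟨f, hf, hfu⟩ := exists_dual_vector'' ℝ u
  refine ⟨StrongDual.positivePart f, fun y hy => ?_, fun y hy => ?_, ?_⟩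
  · rw [StrongDual.positivePart_apply f hy]
    exact StrongDual.posSup_nonneg f hy
  · rw [StrongDual.positivePart_apply f hy]
    refine StrongDual.posSup_le f hy fun z h0 h => ?_
    exact (StrongDual.le_norm_mul_of_mem_Icc f ⟨h0, h⟩).trans
      (mul_le_of_le_one_left (norm_nonneg _) hf)
  · rw [StrongDual.positivePart_apply f hu]
    refine le_trans ?_ (StrongDual.le_posSup f hu le_rfl)
    simpa using hfu.ge

/-- For `u ≥ 0` there is a positive functional which norms `u` and is carried by the band
generated by `u`. -/
theorem StrongDual.exists_norming_carried_by_band {u : E} (hu : 0 ≤ u) :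
    ∃ g : StrongDual ℝ E, 0 ≤ g ∧ (∀ y, 0 ≤ y → g y ≤ ‖y‖) ∧ ‖u‖ ≤ g u ∧
      ∀ y, 0 ≤ y → Tendsto (fun k : ℕ => g (y ⊓ k • u)) atTop (𝓝 (g y)) := by
  obtain ⟨h, h0, hle, hhu⟩ := StrongDual.exists_nonneg_norming hu
  have hmono : ∀ {a b : E}, a ≤ b → h a ≤ h b := fun {a b} hab => by
    have := h0 (b - a) (sub_nonneg.2 hab)
    rw [zero_apply, map_sub] at this
    linarith
  have hk : ∀ k : ℕ, 0 ≤ k • u := fun k => nsmul_nonneg hu k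
  -- The component of `h` in the band of `u`; the supremum is an increasing limit.
  let φ : E → ℝ := fun y => ⨆ k : ℕ, h (y ⊓ k • u)
  have hbdd : ∀ y, BddAbove (range fun k : ℕ => h (y ⊓ k • u)) := fun y =>
    ⟨h y, by rintro _ ⟨k, rfl⟩; exact hmono inf_le_left⟩
  have hlim : ∀ y, Tendsto (fun k : ℕ => h (y ⊓ k • u)) atTop (𝓝 (φ y)) := fun y =>
    tendsto_atTop_ciSup
      (fun i j hij => hmono (inf_le_inf_left y (nsmul_le_nsmul_left hu hij))) (hbdd y)
  have hφ : ∀ y (k : ℕ), h (y ⊓ k • u) ≤ φ y := fun y k => le_ciSup (hbdd y) k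
  have hφh : ∀ y, φ y ≤ h y := fun y => ciSup_le fun k => hmono inf_le_left
  have hφ0 : ∀ y, 0 ≤ y → 0 ≤ φ y := fun y hy =>
    (h0 _ (le_inf hy (hk 0))).trans (hφ y 0)
  obtain ⟨g, hg⟩ := exists_strongDual_of_additive_on_nonneg φ 1 (fun a b ha hb => by
      apply le_antisymm
      · refine ciSup_le fun k => ?_
        refine le_trans ?_ (add_le_add (hφ a k) (hφ b k))
        rw [← map_add]
        apply hmono
        rw [inf_comm, inf_comm a, inf_comm b]
        exact inf_add_le_inf_add_inf (hk k) ha hb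
      · refine le_of_tendsto' ((hlim a).add (hlim b)) fun k => ?_
        -- Adding truncations at level `k` gives an element below the truncation of `a + b` at level
        -- `2k`.
        refine le_trans ?_ (hφ (a + b) (k + k))
        rw [← map_add, add_nsmul]
        exact hmono (le_inf (add_le_add inf_le_left inf_le_left)
          (add_le_add inf_le_right inf_le_right)))
    hφ0 (fun a ha => by rw [one_mul]; exact (hφh a).trans (hle a ha))
  refine ⟨g, fun y hy => ?_, fun y hy => ?_, ?_, fun y hy => ?_⟩
  · rw [hg y hy]; exact hφ0 y hy
  · rw [hg y hy]; exact (hφh y).trans (hle y hy)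
  · rw [hg u hu]
    have := hφ u 1
    rw [one_nsmul, inf_idem] at this
    exact hhu.trans this
  · rw [hg y hy]
    -- Squeeze `h (y ⊓ k • u) ≤ g (y ⊓ k • u) ≤ φ y`; truncating again at level `k` changes nothing.
    refine tendsto_of_tendsto_of_tendsto_of_le_of_le (hlim y) tendsto_const_nhds
      (fun k => ?_) (fun k => ?_)
    · change h _ ≤ g _
      rw [hg _ (le_inf hy (hk k))]
      have := hφ (y ⊓ k • u) k
      rwa [inf_assoc, inf_idem] at this
    · change g _ ≤ φ y
      rw [hg _ (le_inf hy (hk k))]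
      exact ciSup_mono (hbdd y) fun j => hmono (inf_le_inf_right _ inf_le_left)

/-- A functional carried by the band generated by `u` vanishes on the elements disjoint from `u`. -/
theorem StrongDual.eq_zero_of_inf_eq_zero {g : StrongDual ℝ E} {u y : E} (hu : 0 ≤ u)
    (hy : 0 ≤ y) (hg : Tendsto (fun k : ℕ => g (y ⊓ k • u)) atTop (𝓝 (g y))) (h : y ⊓ u = 0) :
    g y = 0 := by
  refine tendsto_nhds_unique hg ?_
  simp [inf_nsmul_eq_zero_of_inf_eq_zero hy hu h]

/-- Positive functionals carried by the bands generated by disjoint elements are disjoint. -/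
theorem StrongDual.inf_eq_zero_of_carried {f g : StrongDual ℝ E} {u v : E} (hf : 0 ≤ f)
    (hg : 0 ≤ g) (hu : 0 ≤ u) (hv : 0 ≤ v) (huv : u ⊓ v = 0)
    (hfu : ∀ y, 0 ≤ y → Tendsto (fun k : ℕ => f (y ⊓ k • u)) atTop (𝓝 (f y)))
    (hgv : ∀ y, 0 ≤ y → Tendsto (fun k : ℕ => g (y ⊓ k • v)) atTop (𝓝 (g y))) :
    f ⊓ g = 0 := by
  refine le_antisymm (fun y hy => ?_) (le_inf hf hg)
  -- Split `y` at `y ⊓ k • u`: `g` vanishes on this piece, and `f` of the remainder tends to zero.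
  have hlim : Tendsto (fun k : ℕ => f y - f (y ⊓ k • u)) atTop (𝓝 0) := by
    simpa using (tendsto_const_nhds (x := f y)).sub (hfu y hy)
  refine ge_of_tendsto' hlim fun k => ?_
  have hk : 0 ≤ k • u := nsmul_nonneg hu k
  have hz : 0 ≤ y ⊓ k • u := le_inf hy hk
  have h1 := (inf_le_left : f ⊓ g ≤ f) (y - y ⊓ k • u) (sub_nonneg.2 inf_le_left)
  have h2 := (inf_le_right : f ⊓ g ≤ g) _ hz
  have h3 : g (y ⊓ k • u) = 0 := by
    refine StrongDual.eq_zero_of_inf_eq_zero hv hz (hgv _ hz) ?_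
    refine inf_eq_zero_of_le_of_le hz hv inf_le_right le_rfl ?_
    rw [inf_comm] at huv ⊢
    exact inf_nsmul_eq_zero_of_inf_eq_zero hv hu huv k
  rw [map_sub, map_sub] at h1
  linarith

theorem StrongDual.abs_eq_self_of_nonneg {g : StrongDual ℝ E} (hg : 0 ≤ g) : |g| = g := by
  refine sup_eq_left.2 fun y hy => ?_
  have := hg y hy
  rw [zero_apply] at this
  rw [neg_apply]
  linarith

theorem StrongDual.abs_apply_le_apply_abs {g : StrongDual ℝ E} (hg : 0 ≤ g) (y : E) :
    |g y| ≤ g |y| := by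
  have h1 := hg (|y| - y) (sub_nonneg.2 (le_abs_self y))
  have h2 := hg (|y| + y) (by rw [← sub_neg_eq_add]; exact sub_nonneg.2 (neg_le_abs y))
  rw [zero_apply, map_sub] at h1
  rw [zero_apply, map_add] at h2
  rw [abs_le]
  constructor <;> linarith

end NormedLattice

/-! ### Weak summability and Dunford–Pettis sets. -/

section NormedSpace

variable {X : Type*} [NormedAddCommGroup X] [NormedSpace ℝ X]

theorem isWeaklyNull_iff {x : ℕ → X} :
    IsWeaklyNull x ↔ ∀ f : StrongDual ℝ X, Tendsto (fun n => f (x n)) atTop (𝓝 0) := by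
  have hinj : Function.Injective (topDualPairing ℝ X).flip := fun a b hab =>
    (SeparatingDual.eq_iff_forall_dual_eq (R := ℝ)).2 fun f => LinearMap.congr_fun hab f
  refine (WeakBilin.tendsto_iff_forall_eval_tendsto _ hinj).trans (forall_congr' fun f => ?_)
  change Tendsto (fun n => f (x n)) atTop (𝓝 (f 0)) ↔ _
  rw [map_zero]

theorem IsWeaklySummable.tendsto_apply {p : ℝ} (hp : 0 < p) {x : ℕ → X}
    (hx : IsWeaklySummable p x) (f : StrongDual ℝ X) :
    Tendsto (fun n => f (x n)) atTop (𝓝 0) := by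
  have h := (hx f).tendsto_atTop_zero.rpow_const (p := 1 / p) (Or.inr (by positivity))
  rw [Real.zero_rpow (by positivity)] at h
  rw [tendsto_zero_iff_abs_tendsto_zero]
  refine h.congr fun n => ?_
  rw [← Real.rpow_mul (abs_nonneg _), mul_one_div_cancel hp.ne', Real.rpow_one]
  rfl

theorem IsWeaklySummable.isWeaklyNull_inclusionInDoubleDual {p : ℝ} (hp : 0 < p) {x : ℕ → X}
    (hx : IsWeaklySummable p x) :
    IsWeaklyNull fun n => NormedSpace.inclusionInDoubleDual ℝ X (x n) :=
  isWeaklyNull_iff.2 fun Φ =>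
    hx.tendsto_apply hp (Φ.comp (NormedSpace.inclusionInDoubleDual ℝ X))

/-- Functionals satisfying `∑ |g n y| ^ p ≤ (K * ‖y‖) ^ p` form a weakly `p`-summable sequence
of the dual. -/
theorem isWeaklySummable_of_sum_rpow_le {p K : ℝ} (hp : 1 < p) (hK : 0 ≤ K)
    {g : ℕ → StrongDual ℝ X}
    (hg : ∀ N y, ∑ n ∈ Finset.range N, |g n y| ^ p ≤ (K * ‖y‖) ^ p) :
    IsWeaklySummable p g := by
  intro φ
  have hp0 : 0 < p := by linarith
  have hpq : p.HolderConjugate p.conjExponent := Real.HolderConjugate.conjExponent hp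
  set q := p.conjExponent
  refine summable_of_sum_range_le (c := (‖φ‖ * K) ^ p) (fun n => by positivity) fun N => ?_
  set S := ∑ n ∈ Finset.range N, |φ (g n)| ^ p with hSdef
  have hS0 : 0 ≤ S := Finset.sum_nonneg fun n _ => by positivity
  rcases hS0.eq_or_lt with hS | hS
  · rw [← hS]; positivity
  -- The extremal coefficients in Hölder's inequality: `∑ a n * φ (g n) = S` and `∑ |a n| ^ q ≤ S`.
  let a : ℕ → ℝ := fun n => (SignType.sign (φ (g n)) : ℝ) * |φ (g n)| ^ (p - 1)
  have ha : ∀ n, |a n| ≤ |φ (g n)| ^ (p - 1) := fun n => by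
    rw [abs_mul, abs_of_nonneg (Real.rpow_nonneg (abs_nonneg _) _)]
    refine mul_le_of_le_one_left (by positivity) ?_
    cases SignType.sign (φ (g n)) <;> simp
  have haS : ∑ n ∈ Finset.range N, |a n| ^ q ≤ S := by
    refine Finset.sum_le_sum fun n _ => ?_
    refine (Real.rpow_le_rpow (abs_nonneg _) (ha n) hpq.symm.nonneg).trans_eq ?_
    rw [← Real.rpow_mul (abs_nonneg _), hpq.sub_one_mul_conj]
  have hSa : S = φ (∑ n ∈ Finset.range N, a n • g n) := by
    rw [map_sum]
    refine Finset.sum_congr rfl fun n _ => ?_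
    rw [map_smul, smul_eq_mul, mul_right_comm, sign_mul_self, ← Real.rpow_one_add']
    · congr 1; ring
    · exact abs_nonneg _
    · linarith
  have hnorm : ‖∑ n ∈ Finset.range N, a n • g n‖ ≤ K * S ^ (1 / q) := by
    refine ContinuousLinearMap.opNorm_le_bound _ (by positivity) fun y => ?_
    have h1 : ‖(∑ n ∈ Finset.range N, a n • g n) y‖
        ≤ ∑ n ∈ Finset.range N, |g n y| * |a n| := by
      rw [sum_apply]
      refine (norm_sum_le _ _).trans_eq (Finset.sum_congr rfl fun n _ => ?_)
      rw [smul_apply, smul_eq_mul, norm_mul, mul_comm, Real.norm_eq_abs, Real.norm_eq_abs]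
    have h2 := Real.inner_le_Lp_mul_Lq (Finset.range N) (fun n => |g n y|) (fun n => |a n|) hpq
    simp only [abs_abs] at h2
    have h3 : (∑ n ∈ Finset.range N, |g n y| ^ p) ^ (1 / p) ≤ K * ‖y‖ := by
      refine (Real.rpow_le_rpow (Finset.sum_nonneg fun n _ => by positivity) (hg N y)
        (by positivity)).trans_eq ?_
      rw [← Real.rpow_mul (by positivity), mul_one_div_cancel hp0.ne', Real.rpow_one]
    have h4 : (∑ n ∈ Finset.range N, |a n| ^ q) ^ (1 / q) ≤ S ^ (1 / q) :=
      Real.rpow_le_rpow (Finset.sum_nonneg fun n _ => by positivity) haS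
        (one_div_nonneg.2 hpq.symm.nonneg)
    calc _ ≤ _ := h1
      _ ≤ _ := h2
      _ ≤ (K * ‖y‖) * S ^ (1 / q) := by gcongr
      _ = _ := by ring
  have hle : S ≤ (‖φ‖ * K) * S ^ (1 / q) := by
    calc S ≤ ‖φ (∑ n ∈ Finset.range N, a n • g n)‖ := hSa ▸ Real.le_norm_self _
      _ ≤ ‖φ‖ * ‖∑ n ∈ Finset.range N, a n • g n‖ := φ.le_opNorm _
      _ ≤ ‖φ‖ * (K * S ^ (1 / q)) := by gcongr
      _ = _ := by ring
  have hsplit : S = S ^ (1 / p) * S ^ (1 / q) := by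
    rw [← Real.rpow_add hS, one_div, one_div, hpq.inv_add_inv_eq_one, Real.rpow_one]
  have hroot : S ^ (1 / p) ≤ ‖φ‖ * K := by
    refine le_of_mul_le_mul_right ?_ (Real.rpow_pos_of_pos hS (1 / q))
    rwa [← hsplit]
  have := Real.rpow_le_rpow (by positivity) hroot hp0.le
  rwa [← Real.rpow_mul hS0, one_div_mul_cancel hp0.ne', Real.rpow_one] at this

/-- The range of a norm null sequence of a Banach space is a Dunford-Pettis set. -/
theorem isDunfordPettisSet_range_of_tendsto_zero [CompleteSpace X] {x : ℕ → X}
    (hx : Tendsto x atTop (𝓝 0)) : IsDunfordPettisSet (range x) := by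
  intro f hf
  have hpt : ∀ y, Tendsto (fun n => f n y) atTop (𝓝 0) := fun y =>
    isWeaklyNull_iff.1 hf (NormedSpace.inclusionInDoubleDual ℝ X y)
  -- The uniform bound handles the tail of `x`; pointwise convergence handles the finitely many
  -- remaining terms.
  obtain ⟨M, hM⟩ := banach_steinhaus (g := f) fun y => by
    obtain ⟨C, hC⟩ := (hpt y).norm.bddAbove_range
    exact ⟨C, fun n => hC ⟨n, rfl⟩⟩
  have hM0 : 0 ≤ M := (norm_nonneg _).trans (hM 0)
  rw [Metric.tendstoUniformlyOn_iff]
  intro ε hε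
  have hsmall : ∀ᶠ k in atTop, M * ‖x k‖ < ε := by
    have : Tendsto (fun k => M * ‖x k‖) atTop (𝓝 0) := by
      simpa using hx.norm.const_mul M
    exact this.eventually_lt_const hε
  obtain ⟨K, hK⟩ := eventually_atTop.1 hsmall
  have hfin : ∀ᶠ n in atTop, ∀ k ∈ Finset.range K, |f n (x k)| < ε := by
    rw [Filter.eventually_all_finset]
    intro k _
    have := (hpt (x k)).abs
    rw [abs_zero] at this
    exact this.eventually_lt_const hε
  filter_upwards [hfin] with n hn
  rintro _ ⟨k, rfl⟩
  rw [dist_zero_left, Real.norm_eq_abs]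
  rcases lt_or_ge k K with hk | hk
  · exact hn k (Finset.mem_range.2 hk)
  · calc |f n (x k)| ≤ ‖f n‖ * ‖x k‖ := (f n).le_opNorm _
      _ ≤ M * ‖x k‖ := by gcongr; exact hM n
      _ < ε := hK k hk

end NormedSpace

/-! ### Norm convergence and the theorem. -/

section Main

variable {E : Type*} [NormedAddCommGroup E] [NormedSpace ℝ E]
  [Lattice E] [HasSolidNorm E] [IsOrderedAddMonoid E] [IsOrderedModule ℝ E]

/-- The positive parts of a disjoint weakly `p`-summable sequence tend to zero in norm, when `E`
has cotype `p` and `E*` has the disjoint Dunford-Pettis property of order `p`. -/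
theorem tendsto_norm_posPart_zero {p : ℝ} (hp : 2 ≤ p) (hcotype : HasCotype E p)
    (hdual : HasDisjointDPP p (StrongDual ℝ E)) {x : ℕ → E} (hd : IsDisjointSeq x)
    (hx : IsWeaklySummable p x) : Tendsto (fun n => ‖(x n)⁺‖) atTop (𝓝 0) := by
  have hp0 : 0 < p := by linarith
  have hu : ∀ n, 0 ≤ (x n)⁺ := fun n => posPart_nonneg _
  have hle : ∀ n, (x n)⁺ ≤ |x n| := fun n => sup_le (le_abs_self _) (abs_nonneg _)
  have huu : ∀ m n, m ≠ n → (x m)⁺ ⊓ (x n)⁺ = 0 := fun m n hmn =>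
    inf_eq_zero_of_le_of_le (hu m) (hu n) (hle m) (hle n) (hd m n hmn)
  choose g hg0 hgn hgu hgt using fun n => StrongDual.exists_norming_carried_by_band (hu n)
  have hgd : IsDisjointSeq g := fun m n hmn => by
    rw [StrongDual.abs_eq_self_of_nonneg (hg0 m), StrongDual.abs_eq_self_of_nonneg (hg0 n)]
    exact StrongDual.inf_eq_zero_of_carried (hg0 m) (hg0 n) (hu m) (hu n) (huu m n hmn)
      (hgt m) (hgt n)
  obtain ⟨C, hC, hcot⟩ := hcotype.exists_sum_rpow_norm_le hp0
  have hgs : IsWeaklySummable p g := by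
    refine isWeaklySummable_of_sum_rpow_le (by linarith) hC.le fun N y => ?_
    -- The truncations are disjoint and below `|y|`, so the cotype bound is uniform in `k` and
    -- passes to the limit.
    have hlim : Tendsto (fun k : ℕ => ∑ n ∈ Finset.range N, g n (|y| ⊓ k • (x n)⁺) ^ p) atTop
        (𝓝 (∑ n ∈ Finset.range N, g n |y| ^ p)) :=
      tendsto_finsetSum _ fun n _ =>
        (hgt n |y| (abs_nonneg y)).rpow_const (Or.inr hp0.le)
    refine le_trans (Finset.sum_le_sum fun n _ => Real.rpow_le_rpow (abs_nonneg _)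
      (StrongDual.abs_apply_le_apply_abs (hg0 n) y) hp0.le) (le_of_tendsto' hlim fun k => ?_)
    have hk : ∀ n, 0 ≤ k • (x n)⁺ := fun n => nsmul_nonneg (hu n) k
    have hz : ∀ n, 0 ≤ |y| ⊓ k • (x n)⁺ := fun n => le_inf (abs_nonneg y) (hk n)
    have h := hcot N (fun n => |y| ⊓ k • (x n)⁺) |y| (abs_nonneg y) (fun n => hz n)
      (fun n => inf_le_left) fun m n hmn => by
        refine inf_eq_zero_of_le_of_le (hz m) (hz n) inf_le_right inf_le_right ?_
        refine inf_nsmul_eq_zero_of_inf_eq_zero (hk m) (hu n) ?_ k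
        rw [inf_comm]
        exact inf_nsmul_eq_zero_of_inf_eq_zero (hu n) (hu m)
          (huu n m fun h => hmn (Fin.ext h.symm)) k
    rw [norm_abs_eq_norm, Fin.sum_univ_eq_sum_range (fun n => ‖|y| ⊓ k • (x n)⁺‖ ^ p)] at h
    refine le_trans (Finset.sum_le_sum fun n _ => ?_) h
    exact Real.rpow_le_rpow (hg0 n _ (hz n)) (hgn n _ (hz n)) hp0.le
  have hunif := hdual g hgd hgs _ (hx.isWeaklyNull_inclusionInDoubleDual hp0)
  rw [Metric.tendstoUniformlyOn_iff] at hunif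
  rw [Metric.tendsto_atTop']
  intro ε hε
  obtain ⟨N, hN⟩ := eventually_atTop.1 (hunif ε hε)
  refine ⟨N, fun n hn => ?_⟩
  have h := hN n hn.le (g n) ⟨n, rfl⟩
  rw [dist_zero_left, NormedSpace.dual_def, Real.norm_eq_abs] at h
  -- `(x n)⁻` is disjoint from `(x n)⁺`, whose band carries `g n`.
  have hneg : g n (x n)⁻ = 0 := by
    refine StrongDual.eq_zero_of_inf_eq_zero (hu n) (negPart_nonneg _)
      (hgt n _ (negPart_nonneg _)) ?_
    rw [inf_comm]
    exact posPart_inf_negPart_eq_zero _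
  have heq : g n (x n) = g n (x n)⁺ := by
    conv_lhs => rw [← posPart_sub_negPart (x n), map_sub, hneg, sub_zero]
  rw [dist_zero_right, norm_norm]
  exact (hgu n).trans_lt (heq ▸ (le_abs_self _).trans_lt h)

end Main

theorem proposition2p4 {E : Type*} [NormedAddCommGroup E] [NormedSpace ℝ E] [CompleteSpace E]
    [Lattice E] [HasSolidNorm E] [IsOrderedAddMonoid E] [IsOrderedModule ℝ E]
    (p : ℝ) (hp : 2 ≤ p) (hcotype : HasCotype E p)
    (hdual : HasDisjointDPP p (StrongDual ℝ E)) :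
    HasDisjointDPP p E := by
  intro x hd hx
  have hpos := tendsto_norm_posPart_zero hp hcotype hdual hd hx
  have hneg := tendsto_norm_posPart_zero hp hcotype hdual (x := fun n => -x n)
    (fun m n hmn => by simpa using hd m n hmn) (fun f => by simpa using hx f)
  refine isDunfordPettisSet_range_of_tendsto_zero ?_
  rw [tendsto_zero_iff_norm_tendsto_zero]
  refine squeeze_zero (fun n => norm_nonneg _) (fun n => ?_) (by simpa using hpos.add hneg)
  calc ‖x n‖ = ‖(x n)⁺ - (x n)⁻‖ := by rw [posPart_sub_negPart]
    _ ≤ ‖(x n)⁺‖ + ‖(x n)⁻‖ := norm_sub_le _ _
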